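/- Let $k$ be a field, let $\Sigma$ be a finite alphabet, and let $w$ be a right-infinite pure morphic word over $\Sigma$ in which every letter of $\Sigma$ occurs. Here $w$ is called pure morphic if $w=\phi^{\omega}(b)$, the right-infinite word having every $\phi^n(b)$ as a prefix, for some endomorphism $\phi$ of the free monoid $\Sigma^*$ and some letter $b$ such that $\phi(b)=bx$, where $x$ is not a product of mortal letters (a letter $a$ is mortal if $\phi^j(a)$ is the empty word for some $j$). Let $A_w$ be the iterative algebra of $w$: the quotient of the free unital associative $k$-algebra on $\Sigma$ by the two-sided ideal generated by all finite words over $\Sigma$ that do not occur as (contiguous) subwords of $w$. Then: 1. $A_w$ is prime if and only if the first letter of $w$ occurs at least twice in $w$. 2. $A_w$ is semiprime if and only if $A_w$ is prime. 3. $A_w$ is just infinite (that is, $\dim_k A_w=\infty$ and every nonzero two-sided ideal has finite codimension) if and only if $w$ is uniformly recurrent (that is, for every subword $v$ of $w$ there is some $N=N(v)$ such that every block of $N$ consecutive letters of $w$ contains $v$ as a subword). 4. $A_w$ satisfies a polynomial identity (that is, some nonzero noncommutative polynomial over $k$ vanishes identically on $A_w$) if and only if $w$ is eventually periodic. 5.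 $A_w$ is right noetherian if and only if $w$ is eventually periodic. -/

import Mathlib

namespace IterativeAlgebra

/-! ## Words and morphisms

A right-infinite word over `α` is a function `ℕ → α`; finite words are lists, or elements
of the free monoid on `α`. -/

/-- The block of `n` consecutive letters of `w` that starts at position `i`. -/
def block {α : Type*} (w : ℕ → α) (i n : ℕ) : List α :=
  (List.range n).map fun j => w (i + j)

/-- The finite word `u` occurs as a (contiguous) subword of the right-infinite word `w`. -/
def IsSubword {α : Type*} (w : ℕ → α) (u : List α) : Prop :=
  ∃ i, block w i u.length = u

/-- A letter is mortal if some iterate of the morphism sends it to the empty word. -/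
def IsMortal {α : Type*} (φ : FreeMonoid α →* FreeMonoid α) (a : α) : Prop :=
  ∃ j : ℕ, φ^[j] (FreeMonoid.of a) = 1

/-- `φ` is prolongable on `b` if `φ b = b x`, where `x` is not in the submonoid generated
by the mortal letters. -/
def IsProlongable {α : Type*} (φ : FreeMonoid α →* FreeMonoid α) (b : α) : Prop :=
  ∃ x : FreeMonoid α, φ (FreeMonoid.of b) = FreeMonoid.of b * x ∧
    x ∉ Submonoid.closure (FreeMonoid.of '' {a : α | IsMortal φ a})

/-- `w` is the limit of `b, φ b, φ² b, …`: each of these words is a prefix of `w`. When `φ`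
is prolongable on `b`, their lengths are unbounded, so this determines `w`. -/
def IsIterationLimit {α : Type*} (φ : FreeMonoid α →* FreeMonoid α) (b : α)
    (w : ℕ → α) : Prop :=
  ∀ n : ℕ, block w 0 (FreeMonoid.toList (φ^[n] (FreeMonoid.of b))).length =
    FreeMonoid.toList (φ^[n] (FreeMonoid.of b))

/-- A pure morphic word: the limit of the iterates of a morphism at a letter on which the
morphism is prolongable. -/
def IsPureMorphic {α : Type*} (w : ℕ → α) : Prop :=
  ∃ (φ : FreeMonoid α →* FreeMonoid α) (b : α),
    IsProlongable φ b ∧ IsIterationLimit φ b w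

/-- Every subword `v` of `w` occurs in every block of `N = N(v)` consecutive letters. -/
def IsUniformlyRecurrent {α : Type*} (w : ℕ → α) : Prop :=
  ∀ v : List α, IsSubword w v → ∃ N : ℕ, ∀ i : ℕ, v <:+: block w i N

/-- From some position on, `w` has a positive period. -/
def IsEventuallyPeriodic {α : Type*} (w : ℕ → α) : Prop :=
  ∃ p : ℕ, 0 < p ∧ ∃ n₀ : ℕ, ∀ n, n₀ ≤ n → w (n + p) = w n

/-! ## The algebra of a word -/

/-- The monomial in the free algebra that corresponds to a finite word. -/
def monomial (k : Type*) [Field k] {α : Type*} (u : List α) : FreeAlgebra k α :=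
  (u.map (FreeAlgebra.ι k)).prod

/-- The two-sided ideal of the free algebra generated by all finite words that do not occur
as subwords of `w`. -/
def nonSubwordIdeal (k : Type*) [Field k] {α : Type*} (w : ℕ → α) :
    TwoSidedIdeal (FreeAlgebra k α) :=
  TwoSidedIdeal.span (monomial k '' {u : List α | ¬ IsSubword w u})

/-- The algebra `A_w`, the quotient of the free algebra by `nonSubwordIdeal k w`. -/
abbrev Alg (k : Type*) [Field k] {α : Type*} (w : ℕ → α) : Type _ :=
  (nonSubwordIdeal k w).ringCon.Quotient

/-! ## Properties of (noncommutative, unital) rings and algebras -/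

/-- A prime ring: nonzero, and `a R b = 0` only if `a = 0` or `b = 0`. -/
def IsPrimeRing (R : Type*) [Ring R] : Prop :=
  Nontrivial R ∧ ∀ a b : R, (∀ r : R, a * r * b = 0) → a = 0 ∨ b = 0

/-- A semiprime ring: `a R a = 0` only if `a = 0`. -/
def IsSemiprimeRing (R : Type*) [Ring R] : Prop :=
  ∀ a : R, (∀ r : R, a * r * a = 0) → a = 0

/-- A just infinite algebra: infinite-dimensional, and every nonzero two-sided ideal has
finite codimension. -/
def IsJustInfinite (k A : Type*) [Field k] [Ring A] [Algebra k A] : Prop :=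
  ¬ Module.Finite k A ∧
    ∀ I : TwoSidedIdeal A, I ≠ ⊥ → Module.Finite k I.ringCon.Quotient

/-- Some nonzero noncommutative polynomial over `k` vanishes on all of `A`. -/
def IsPI (k A : Type*) [Field k] [Ring A] [Algebra k A] : Prop :=
  ∃ f : FreeAlgebra k ℕ, f ≠ 0 ∧ ∀ g : ℕ → A, FreeAlgebra.lift k g f = 0

/-- A right noetherian ring: the opposite ring is left noetherian (Mathlib's
`IsNoetherianRing` is about left ideals). -/
def IsRightNoetherian (R : Type*) [Ring R] : Prop :=
  IsNoetherianRing (MulOpposite R)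

end IterativeAlgebra

/-!
The algebra `A_w` acts faithfully on functions `ℕ → k` by partial shifts (`shiftRep`): a letter
shifts at the positions of `w` where it stands. So `A_w` is an algebra of upper triangular
`ℕ × ℕ` matrices, and the entry `(i, j)` is the coefficient of the subword of `w` between `i`
and `j` (`entry`, `exists_entry_ne_zero`). All statements are read off from these entries.

* If `b = w 0` occurs only once, then `b A_w b = 0`, so `A_w` is not semiprime
  (`IsSemiprimeRing.first_letter_recurs`). If it occurs again, then the same holds for all the
  prefixes `φ^m b`, so every subword recurs arbitrarily far out (`IsPureMorphic.recurrent`),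
  and two nonzero elements can be joined by a word so that their leading coefficients multiply
  (`isPrimeRing_of_recurrent`). This is where the morphism enters.
* For a uniformly recurrent `w`, the leading word, in a degree-lexicographic order, of a nonzero
  element of an ideal occurs in all long subwords; reduction by it leaves only short words
  (`IsUniformlyRecurrent.finite_quotient`). If `v` is missing from arbitrarily long blocks, these
  are independent modulo the ideal of `v` (`IsJustInfinite.isUniformlyRecurrent`).
* If `w` is not eventually periodic, then the number of words of length `n` that occur infinitely
  often grows strictly with `n`, so `w` has many distinct blocks of equal length in disjoint
  places (`exists_disjoint_blocks`). They give a substitution in which a chosen monomial of a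
  given polynomial is not cancelled (`IsPI.isEventuallyPeriodic`).
* If `w` is not eventually periodic, then the tree of its subwords branches infinitely often, and
  branches off one path generate a strictly increasing chain of right ideals; this appears below
  as a maximality argument (`IsRightNoetherian.isEventuallyPeriodic`).
* If `w` is eventually periodic, then `A_w` is a finitely generated right module over the
  polynomial ring in the sum of the blocks of period length
  (`IsEventuallyPeriodic.exists_finite`). So `A_w` is right noetherian, and it embeds into the
  endomorphisms of a finitely generated `k[X]`-module, which satisfy a standard identity.
-/

namespace IterativeAlgebra

/-! ### Blocks -/

section Blocks

variable {α : Type*}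

@[simp] lemma length_block (w : ℕ → α) (i n : ℕ) : (block w i n).length = n := by
  simp [block]

@[simp] lemma block_zero (w : ℕ → α) (i : ℕ) : block w i 0 = [] := rfl

lemma block_succ (w : ℕ → α) (i n : ℕ) : block w i (n + 1) = w i :: block w (i + 1) n := by
  simp [block, List.range_succ_eq_map, Function.comp_def, Nat.add_right_comm, Nat.add_assoc]

lemma block_one (w : ℕ → α) (i : ℕ) : block w i 1 = [w i] := rfl

lemma block_add (w : ℕ → α) (i m n : ℕ) :
    block w i (m + n) = block w i m ++ block w (i + m) n := by
  simp [block, List.range_add, Function.comp_def, Nat.add_assoc]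

lemma block_succ' (w : ℕ → α) (i n : ℕ) : block w i (n + 1) = block w i n ++ [w (i + n)] :=
  block_add w i n 1

lemma isSubword_block (w : ℕ → α) (i n : ℕ) : IsSubword w (block w i n) :=
  ⟨i, by rw [length_block]⟩

lemma block_eq_iff {w : ℕ → α} {i j n : ℕ} :
    block w i n = block w j n ↔ ∀ l < n, w (i + l) = w (j + l) := by
  simp [block, List.map_inj_left]

lemma block_infix {w : ℕ → α} {i j m n : ℕ} (hij : i ≤ j) (h : j + m ≤ i + n) :
    block w j m <:+: block w i n := by
  obtain ⟨c, rfl⟩ := Nat.exists_eq_add_of_le hij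
  obtain ⟨d, rfl⟩ : ∃ d, n = c + m + d := ⟨n - (c + m), by omega⟩
  rw [block_add, block_add]
  exact ⟨_, _, rfl⟩

lemma block_append_eq {w : ℕ → α} {i : ℕ} {u v : List α}
    (h : block w i (u ++ v).length = u ++ v) :
    block w i u.length = u ∧ block w (i + u.length) v.length = v := by
  rw [List.length_append, block_add] at h
  exact List.append_inj h (length_block _ _ _)

end Blocks

/-! ### The shift representation -/

section Representation

variable (k : Type*) [Field k] {α : Type*} (w : ℕ → α)

open Classical in
/-- The representation of the free algebra on functions `ℕ → k` in which the letter `a` sends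
`f` to `i ↦ f (i + 1)` at the positions `i` where `w` has the letter `a`, and to `0` elsewhere. -/
noncomputable def freeShiftRep : FreeAlgebra k α →ₐ[k] Module.End k (ℕ → k) :=
  FreeAlgebra.lift k fun a =>
    { toFun := fun f i => if w i = a then f (i + 1) else 0
      map_add' := fun f g => by ext i; by_cases h : w i = a <;> simp [h]
      map_smul' := fun c f => by ext i; by_cases h : w i = a <;> simp [h] }

open Classical in
lemma freeShiftRep_monomial (u : List α) (f : ℕ → k) (i : ℕ) :
    freeShiftRep k w (monomial k u) f i =
      if block w i u.length = u then f (i + u.length) else 0 := by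
  induction u generalizing i with
  | nil => simp [monomial]
  | cons a u ih =>
    have : monomial k (a :: u) = FreeAlgebra.ι k a * monomial k u := by simp [monomial]
    rw [this, map_mul, Module.End.mul_apply, freeShiftRep, FreeAlgebra.lift_ι_apply]
    rw [freeShiftRep] at ih
    simp only [LinearMap.coe_mk, AddHom.coe_mk, List.length_cons, block_succ, ih,
      List.cons.injEq, ← ite_and]
    congr 2
    omega

lemma monomial_append (u v : List α) : monomial k (u ++ v) = monomial k u * monomial k v := by
  simp [monomial]

lemma span_monomial : Submodule.span k (Set.range (monomial k (α := α))) = ⊤ := by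
  rw [eq_top_iff]
  rintro x -
  induction x using FreeAlgebra.induction with
  | grade0 r =>
    rw [Algebra.algebraMap_eq_smul_one]
    exact Submodule.smul_mem _ _ (Submodule.subset_span ⟨[], rfl⟩)
  | grade1 a => exact Submodule.subset_span ⟨[a], by simp [monomial]⟩
  | mul x y hx hy =>
    have := Submodule.mul_mem_mul hx hy
    rw [Submodule.span_mul_span] at this
    refine Submodule.span_mono ?_ this
    rintro _ ⟨_, ⟨u, rfl⟩, _, ⟨v, rfl⟩, rfl⟩
    exact ⟨u ++ v, monomial_append k u v⟩
  | add x y hx hy => exact add_mem hx hy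

lemma nonSubwordIdeal_le_ker {x : FreeAlgebra k α} (hx : x ∈ nonSubwordIdeal k w) :
    freeShiftRep k w x = 0 := by
  have : nonSubwordIdeal k w ≤ TwoSidedIdeal.ker (freeShiftRep k w) := by
    rw [nonSubwordIdeal, TwoSidedIdeal.span_le]
    rintro _ ⟨u, hu, rfl⟩
    rw [SetLike.mem_coe, TwoSidedIdeal.mem_ker]
    ext f i
    classical
    rw [freeShiftRep_monomial, if_neg fun h => hu ⟨i, h⟩]
    rfl
  exact (TwoSidedIdeal.mem_ker _).1 (this hx)

/-- The projection of the free algebra onto `A_w`. -/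
noncomputable def toAlg : FreeAlgebra k α →ₐ[k] Alg k w :=
  (nonSubwordIdeal k w).ringCon.mkₐ k

lemma toAlg_surjective : Function.Surjective (toAlg k w) :=
  RingCon.mkₐ_surjective _

lemma toAlg_eq_zero {x : FreeAlgebra k α} (hx : x ∈ nonSubwordIdeal k w) : toAlg k w x = 0 :=
  (RingCon.eq _).2 hx

/-- The shift representation of `A_w`. -/
noncomputable def shiftRep : Alg k w →ₐ[k] Module.End k (ℕ → k) :=
  RingCon.liftₐ (nonSubwordIdeal k w).ringCon (freeShiftRep k w) fun x y h => by
    have := nonSubwordIdeal_le_ker k w ((TwoSidedIdeal.rel_iff _ _ _).1 h)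
    rwa [map_sub, sub_eq_zero] at this

lemma shiftRep_toAlg (x : FreeAlgebra k α) : shiftRep k w (toAlg k w x) = freeShiftRep k w x :=
  rfl

/-- The class of a finite word in `A_w`; it is zero if the word is not a subword of `w`. -/
noncomputable def word (u : List α) : Alg k w := toAlg k w (monomial k u)

variable {k w}

lemma word_append (u v : List α) : word k w (u ++ v) = word k w u * word k w v := by
  rw [word, monomial_append, map_mul]; rfl

lemma word_nil : word k w ([] : List α) = 1 := by
  simp [word, monomial]

lemma word_eq_zero {u : List α} (hu : ¬ IsSubword w u) : word k w u = 0 :=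
  toAlg_eq_zero k w (TwoSidedIdeal.subset_span ⟨u, hu, rfl⟩)

lemma span_word : Submodule.span k (Set.range (word k w)) = ⊤ := by
  have h : Set.range (word k w) = (toAlg k w).toLinearMap '' Set.range (monomial k) := by
    rw [← Set.range_comp]; rfl
  rw [h, Submodule.span_image, span_monomial, Submodule.map_top, LinearMap.range_eq_top]
  exact toAlg_surjective k w

open Classical in
/-- Every element of `A_w` is a linear combination of subwords of `w`. -/
lemma exists_eq_sum_word (x : Alg k w) : ∃ c : List α →₀ k,
    (∀ u ∈ c.support, IsSubword w u) ∧ x = c.sum fun u r => r • word k w u := by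
  have hx : x ∈ Submodule.span k (Set.range (word k w)) := span_word (k := k) (w := w) ▸ trivial
  obtain ⟨c, rfl⟩ := (Finsupp.mem_span_range_iff_exists_finsupp).1 hx
  refine ⟨c.filter (IsSubword w), fun u hu => ?_, ?_⟩
  · rw [Finsupp.support_filter] at hu
    exact (Finset.mem_filter.1 hu).2
  · rw [Finsupp.sum, Finsupp.sum, Finsupp.support_filter, Finset.sum_filter]
    refine Finset.sum_congr rfl fun u hu => ?_
    split_ifs with h
    · rw [Finsupp.filter_apply_pos _ _ h]
    · rw [word_eq_zero h, smul_zero]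

/-- The entry `(i, j)` of an element of `A_w` in the shift representation, seen as an
upper triangular `ℕ × ℕ` matrix. For `i ≤ j` it is the coefficient of the subword of `w` that
occupies the positions from `i` up to but not including `j`. -/
noncomputable def entry (i j : ℕ) : Alg k w →ₗ[k] k :=
  LinearMap.proj i ∘ₗ LinearMap.applyₗ (Pi.single j 1) ∘ₗ (shiftRep k w).toLinearMap

lemma entry_apply (i j : ℕ) (x : Alg k w) : entry i j x = shiftRep k w x (Pi.single j 1) i := rfl

open Classical in
lemma entry_word (i j : ℕ) (u : List α) :
    entry i j (word k w u) = if j = i + u.length ∧ block w i u.length = u then 1 else 0 := by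
  rw [entry_apply, word, shiftRep_toAlg, freeShiftRep_monomial, Pi.single_apply, ← ite_and]
  congr 1
  rw [and_comm, eq_comm (a := j)]

lemma entry_word_block (i n : ℕ) : entry i (i + n) (word k w (block w i n)) = 1 := by
  rw [entry_word, if_pos]; simp

/-- Linear statements about `A_w` need to be checked on words only. -/
lemma induction_word {p : Alg k w → Prop} (x : Alg k w) (hw : ∀ u, p (word k w u))
    (h0 : p 0) (hadd : ∀ x y, p x → p y → p (x + y)) (hsmul : ∀ (c : k) x, p x → p (c • x)) :
    p x := by
  have hx : x ∈ Submodule.span k (Set.range (word k w)) := span_word (k := k) (w := w) ▸ trivial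
  induction hx using Submodule.span_induction with
  | mem x h => obtain ⟨u, rfl⟩ := h; exact hw u
  | zero => exact h0
  | add x y _ _ hx hy => exact hadd x y hx hy
  | smul c x _ hx => exact hsmul c x hx

lemma entry_eq_zero_of_lt {i j : ℕ} (h : j < i) (x : Alg k w) : entry i j x = 0 := by
  induction x using induction_word with
  | hw u => rw [entry_word, if_neg]; omega
  | h0 => exact map_zero _
  | hadd x y hx hy => rw [map_add, hx, hy, add_zero]
  | hsmul c x hx => rw [map_smul, hx, smul_zero]

/-- An entry depends only on the word that stands at the given positions. -/
lemma entry_congr {i j n : ℕ} (h : block w i n = block w j n) (x : Alg k w) :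
    entry i (i + n) x = entry j (j + n) x := by
  induction x using induction_word with
  | hw u =>
    rw [entry_word, entry_word]
    congr 1
    simp only [add_right_inj, eq_iff_iff]
    constructor <;> rintro ⟨rfl, h'⟩ <;> simp_all
  | h0 => simp
  | hadd x y hx hy => rw [map_add, map_add, hx, hy]
  | hsmul c x hx => rw [map_smul, map_smul, hx]

lemma entry_mul (i j : ℕ) (x y : Alg k w) :
    entry i j (x * y) = ∑ m ∈ Finset.Icc i j, entry i m x * entry m j y := by
  have hy : shiftRep k w y (Pi.single j 1) =
      ∑ m ∈ Finset.range (j + 1), entry m j y • Pi.single m (1 : k) := by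
    ext m
    simp only [Finset.sum_apply, Pi.smul_apply, smul_eq_mul, Pi.single_apply, mul_ite, mul_one,
      mul_zero, Finset.sum_ite_eq, Finset.mem_range]
    split_ifs with h
    · rfl
    · exact entry_eq_zero_of_lt (by omega) y
  rw [entry_apply, map_mul, Module.End.mul_apply, hy, map_sum, Finset.sum_apply]
  have hterm : ∀ m, shiftRep k w x (entry m j y • Pi.single m (1 : k)) i =
      entry i m x * entry m j y := fun m => by
    rw [map_smul, Pi.smul_apply, ← entry_apply, smul_eq_mul, mul_comm]
  rw [Finset.sum_congr rfl fun m _ => hterm m]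
  refine (Finset.sum_subset (fun m hm => ?_) fun m hm hm' => ?_).symm
  · simp at hm ⊢; omega
  · rw [entry_eq_zero_of_lt, zero_mul]
    simp at hm hm'; omega

/-- Left multiplication by a word selects a row. -/
lemma entry_word_mul (i n j : ℕ) (y : Alg k w) :
    entry i j (word k w (block w i n) * y) = entry (i + n) j y := by
  by_cases h : i + n ≤ j
  · rw [entry_mul, Finset.sum_eq_single (i + n)]
    · rw [entry_word_block, one_mul]
    · intro m _ hm
      rw [entry_word, if_neg, zero_mul]
      simp [hm]
    · simp; omega
  · rw [entry_eq_zero_of_lt (by omega) y, entry_mul]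
    refine Finset.sum_eq_zero fun m hm => ?_
    rw [entry_word, if_neg, zero_mul]
    simp at hm ⊢; omega

lemma entry_one (i : ℕ) : entry i i (1 : Alg k w) = 1 := by
  rw [← word_nil, entry_word, if_pos]; simp

lemma entry_sum_word (c : List α →₀ k) (i n : ℕ) :
    entry i (i + n) (c.sum fun u r => r • word k w u : Alg k w) = c (block w i n) := by
  rw [Finsupp.sum, map_sum, Finset.sum_eq_single (block w i n)]
  · rw [map_smul, entry_word_block, smul_eq_mul, mul_one]
  · intro u _ hu
    rw [map_smul, entry_word, if_neg, smul_zero]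
    rintro ⟨h, h'⟩
    obtain rfl : n = u.length := by omega
    exact hu h'.symm
  · intro h
    rw [Finsupp.notMem_support_iff.1 h, zero_smul, map_zero]

/-- The shift representation of `A_w` is faithful. -/
lemma exists_entry_ne_zero {x : Alg k w} (hx : x ≠ 0) : ∃ i n, entry i (i + n) x ≠ 0 := by
  obtain ⟨c, hc, rfl⟩ := exists_eq_sum_word x
  obtain ⟨u, hu⟩ : c.support.Nonempty := by
    rw [Finsupp.support_nonempty_iff]
    rintro rfl
    simp at hx
  obtain ⟨i, hi⟩ := hc u hu
  refine ⟨i, u.length, ?_⟩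
  rw [entry_sum_word, hi]
  exact Finsupp.mem_support_iff.1 hu

/-- The entries of an element vanish far away from the diagonal. -/
lemma exists_entry_eq_zero (x : Alg k w) : ∃ N, ∀ i n, N ≤ n → entry i (i + n) x = 0 := by
  induction x using induction_word with
  | hw u =>
    refine ⟨u.length + 1, fun i n hn => ?_⟩
    rw [entry_word, if_neg]; omega
  | h0 => exact ⟨0, fun i n _ => map_zero _⟩
  | hadd x y hx hy =>
    obtain ⟨N, hN⟩ := hx
    obtain ⟨M, hM⟩ := hy
    refine ⟨N + M, fun i n hn => ?_⟩
    rw [map_add, hN i n (by omega), hM i n (by omega), add_zero]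
  | hsmul c x hx =>
    obtain ⟨N, hN⟩ := hx
    exact ⟨N, fun i n hn => by rw [map_smul, hN i n hn, smul_zero]⟩

/-- A nonzero element has a nonzero entry on a last nonzero diagonal. -/
lemma exists_top_entry {x : Alg k w} (hx : x ≠ 0) : ∃ i n, entry i (i + n) x ≠ 0 ∧
    ∀ j m, n < m → entry j (j + m) x = 0 := by
  classical
  obtain ⟨N, hN⟩ := exists_entry_eq_zero x
  have hex : ∃ N, ∀ i n, N ≤ n → entry i (i + n) x = 0 := ⟨N, hN⟩
  have hspec := Nat.find_spec hex
  obtain ⟨i₀, n₀, h₀⟩ := exists_entry_ne_zero hx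
  have hpos : Nat.find hex ≠ 0 := fun h => h₀ (hspec _ _ (by omega))
  have hmin := Nat.find_min hex (m := Nat.find hex - 1) (by omega)
  push Not at hmin
  obtain ⟨i, n, hn, hne⟩ := hmin
  have : n < Nat.find hex := by
    by_contra h
    exact hne (hspec _ _ (by omega))
  exact ⟨i, n, hne, fun j m hm => hspec _ _ (by omega)⟩

end Representation

/-! ### Primeness and recurrence -/

section Prime

variable {k : Type*} [Field k] {α : Type*} {w : ℕ → α}

/-- If the first letter of `w` occurs only once, then its class `a` satisfies `a A_w a = 0`. -/
lemma IsSemiprimeRing.first_letter_recurs (h : IsSemiprimeRing (Alg k w)) :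
    ∃ n : ℕ, 0 < n ∧ w n = w 0 := by
  by_contra! hne
  have hentry : ∀ i j, entry i j (word k w [w 0]) ≠ 0 → i = 0 ∧ j = 1 := by
    intro i j hij
    rw [entry_word] at hij
    obtain ⟨hj, hb⟩ := of_not_not fun hc => hij (if_neg hc)
    rw [List.length_singleton, block_one, List.singleton_inj] at hb
    have : i = 0 := by
      by_contra hi
      exact hne i (by omega) hb
    exact ⟨this, by simp at hj; omega⟩
  have h0 : word k w [w 0] = 0 := by
    refine h _ fun r => ?_
    by_contra hr
    obtain ⟨i, n, hin⟩ := exists_entry_ne_zero hr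
    rw [entry_mul] at hin
    obtain ⟨t, -, ht⟩ := Finset.exists_ne_zero_of_sum_ne_zero hin
    rw [entry_mul, Finset.sum_mul] at ht
    obtain ⟨s, -, hs⟩ := Finset.exists_ne_zero_of_sum_ne_zero ht
    obtain ⟨-, rfl⟩ := hentry _ _ (left_ne_zero_of_mul (left_ne_zero_of_mul hs))
    obtain ⟨rfl, -⟩ := hentry _ _ (right_ne_zero_of_mul hs)
    exact right_ne_zero_of_mul (left_ne_zero_of_mul hs) (entry_eq_zero_of_lt one_pos r)
  have h1 := entry_word_block (k := k) (w := w) 0 1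
  rw [block_one, h0, map_zero] at h1
  exact zero_ne_one h1

lemma IsPrimeRing.isSemiprimeRing {R : Type*} [Ring R] (h : IsPrimeRing R) :
    IsSemiprimeRing R := fun a ha => (h.2 a a ha).elim id id

/-- If every subword of `w` occurs arbitrarily far out, then `A_w` is prime: a word that joins
an occurrence of a longest subword in the support of `a` to a later occurrence of one in the
support of `b` produces a coefficient that cannot cancel. -/
lemma isPrimeRing_of_recurrent
    (h : ∀ i n N : ℕ, ∃ p, N ≤ p ∧ block w p n = block w i n) : IsPrimeRing (Alg k w) := by
  refine ⟨⟨1, 0, fun h10 => ?_⟩, fun a b hab => ?_⟩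
  · have := entry_one (k := k) (w := w) 0
    rw [h10, map_zero] at this
    exact zero_ne_one this
  by_contra! hne
  obtain ⟨i, n, hin, hn⟩ := exists_top_entry hne.1
  obtain ⟨j, m, hjm, hm⟩ := exists_top_entry hne.2
  obtain ⟨q, hq, hqj⟩ := h j m (i + n)
  rw [← entry_congr hqj] at hjm
  obtain ⟨l, rfl⟩ := Nat.exists_eq_add_of_le hq
  have h0 := congrArg (entry i (i + n + l + m)) (hab (word k w (block w (i + n) l)))
  rw [map_zero, mul_assoc, entry_mul, Finset.sum_eq_single (i + n), entry_word_mul] at h0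
  · exact mul_ne_zero hin hjm h0
  · intro s hs hsn
    rw [Finset.mem_Icc] at hs
    rcases lt_or_gt_of_ne hsn with hlt | hgt
    · rw [entry_mul, Finset.sum_eq_zero, mul_zero]
      intro t ht
      rw [Finset.mem_Icc] at ht
      rw [entry_word, length_block]
      split_ifs with hc
      · -- the path stops short of the last position, which is out of reach for `b`
        obtain ⟨c, hc'⟩ := Nat.exists_eq_add_of_le (show t ≤ i + n + l + m by omega)
        rw [hc', hm t c (by omega), mul_zero]
      · rw [zero_mul]
    · obtain ⟨c, rfl⟩ := Nat.exists_eq_add_of_le hs.1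
      rw [hn i c (by omega), zero_mul]
  · simp; omega

/-! ### Recurrence of pure morphic words -/

lemma iterate_mul (φ : FreeMonoid α →* FreeMonoid α) (n : ℕ) (x y : FreeMonoid α) :
    φ^[n] (x * y) = φ^[n] x * φ^[n] y := iterate_map_mul φ n x y

/-- If an iterate of `φ` erases a word, then it erases each of its letters. -/
lemma iterate_ne_one {φ : FreeMonoid α →* FreeMonoid α} {x : FreeMonoid α}
    (hx : x ∉ Submonoid.closure (FreeMonoid.of '' {a : α | IsMortal φ a})) (n : ℕ) :
    φ^[n] x ≠ 1 := by
  contrapose! hx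
  induction x using FreeMonoid.inductionOn' with
  | one => exact one_mem _
  | of_mul a x ih =>
    rw [iterate_mul] at hx
    have hl := congrArg FreeMonoid.length hx
    rw [FreeMonoid.length_mul, FreeMonoid.length_one] at hl
    refine mul_mem (Submonoid.subset_closure ⟨a, ⟨n, ?_⟩, rfl⟩) (ih ?_)
    · exact FreeMonoid.length_eq_zero.1 (by omega)
    · exact FreeMonoid.length_eq_zero.1 (by omega)

lemma IsProlongable.lt_length {φ : FreeMonoid α →* FreeMonoid α} {b : α}
    (h : IsProlongable φ b) (n : ℕ) : n < (φ^[n] (FreeMonoid.of b)).length := by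
  obtain ⟨x, hb, hx⟩ := h
  induction n with
  | zero => simp
  | succ n ih =>
    rw [Function.iterate_succ_apply, hb, iterate_mul, FreeMonoid.length_mul]
    have := mt FreeMonoid.length_eq_zero.1 (iterate_ne_one hx n)
    omega

/-- If the first letter `b` of a pure morphic word occurs again, then some `φ^M b` begins with
`b y b`, so `φ^m b` occurs again after `φ^m (b y)`, for every `m`. -/
lemma IsPureMorphic.recurrent (hw : IsPureMorphic w) (h : ∃ n : ℕ, 0 < n ∧ w n = w 0)
    (i n N : ℕ) : ∃ p, N ≤ p ∧ block w p n = block w i n := by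
  obtain ⟨φ, b, hp, hl⟩ := hw
  obtain ⟨l, hl0, hlw⟩ := h
  have hb : w 0 = b := by
    have := hl 0
    simpa [block_succ] using this
  set M := l + 1
  set m := i + n + N
  have hlen := hp.lt_length m
  have hlenM := hp.lt_length M
  -- `φ^M b = b y b z`, where the second `b` is at position `l`
  obtain ⟨z, hz⟩ : ∃ z : FreeMonoid α, φ^[M] (FreeMonoid.of b) =
      FreeMonoid.of b * FreeMonoid.ofList (block w 1 (l - 1)) * FreeMonoid.of b * z := by
    obtain ⟨c, hc⟩ := Nat.exists_eq_add_of_le (Nat.succ_le_of_lt hlenM)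
    refine ⟨FreeMonoid.ofList (block w (l + 1) (c + 1)), ?_⟩
    apply FreeMonoid.toList.injective
    have hc' : (φ^[M] (FreeMonoid.of b)).toList.length = 1 + (l - 1) + 1 + (c + 1) := by
      change (φ^[M] (FreeMonoid.of b)).length = _
      omega
    have h2 : 0 + (1 + (l - 1) + 1) = l + 1 := by omega
    have h3 : 0 + (1 + (l - 1)) = l := by omega
    rw [← hl M, hc', block_add, block_add, block_add, block_one, h2, h3, block_one, hlw, hb]
    rfl
  have hpre := hl (m + M)
  rw [Function.iterate_add_apply, hz, iterate_mul, iterate_mul, FreeMonoid.toList_mul,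
    FreeMonoid.toList_mul] at hpre
  have hocc := (block_append_eq (block_append_eq hpre).1).2
  set p := (φ^[m] (FreeMonoid.of b * FreeMonoid.ofList (block w 1 (l - 1)))).toList.length
  have hple : m < p := by
    change m < FreeMonoid.length _
    rw [iterate_mul, FreeMonoid.length_mul]
    omega
  have hlen' : i + n ≤ (φ^[m] (FreeMonoid.of b)).toList.length := by
    change _ ≤ FreeMonoid.length _
    omega
  refine ⟨p + i, by omega, ?_⟩
  rw [← hl m, length_block, block_eq_iff] at hocc
  rw [block_eq_iff]
  intro t ht
  have := hocc (i + t) (by omega)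
  rwa [zero_add, zero_add, ← add_assoc] at this

end Prime

/-! ### Words that are not eventually periodic -/

section Periodicity

variable {α : Type*} [Finite α] {w : ℕ → α}

/-- If from some position on each letter is determined by the `n` letters before it, then `w` is
eventually periodic, as some block of length `n` repeats. -/
lemma exists_right_special (hw : ¬ IsEventuallyPeriodic w) (n N : ℕ) :
    ∃ i j, N ≤ i ∧ N ≤ j ∧ block w i n = block w j n ∧ w (i + n) ≠ w (j + n) := by
  by_contra! hdet
  have hfin : Finite {l : List α // l.length = n} := (List.finite_length_eq α n).to_subtype
  obtain ⟨i, j, hij, hb⟩ := Finite.exists_ne_map_eq_of_infinite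
    fun i : ℕ => (⟨block w (N + i) n, length_block _ _ _⟩ : {l : List α // l.length = n})
  wlog hlt : i < j generalizing i j
  · exact this j i hij.symm hb.symm (by omega)
  have hb' : ∀ m, block w (N + i + m) n = block w (N + j + m) n := by
    intro m
    induction m with
    | zero => exact Subtype.ext_iff.1 hb
    | succ m ih =>
      have h1 : block w (N + i + m) (n + 1) = block w (N + j + m) (n + 1) := by
        rw [block_succ', block_succ', ih, hdet _ _ (by omega) (by omega) ih]
      rw [block_succ, block_succ] at h1
      exact (List.cons.inj h1).2
  refine hw ⟨j - i, by omega, N + i + n, fun t ht => ?_⟩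
  obtain ⟨m, rfl⟩ := Nat.exists_eq_add_of_le ht
  have h1 := hdet _ _ (by omega) (by omega) (hb' m)
  rw [show N + i + n + m = N + i + m + n by omega, h1]
  congr 1
  omega

/-- The words of length `n` that occur infinitely often in `w`. -/
def limitWords (w : ℕ → α) (n : ℕ) : Set (List α) :=
  {u | u.length = n ∧ ∃ᶠ i in Filter.atTop, block w i n = u}

lemma finite_limitWords (w : ℕ → α) (n : ℕ) : (limitWords w n).Finite :=
  (List.finite_length_eq α n).subset fun _ hu => hu.1

lemma exists_block_mem_limitWords (w : ℕ → α) (n : ℕ) :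
    ∃ N, ∀ i, N ≤ i → block w i n ∈ limitWords w n := by
  have h : ∀ u ∈ {u : List α | u.length = n} \ limitWords w n,
      ∀ᶠ i in Filter.atTop, block w i n ≠ u := fun u hu => by
    by_contra hc
    exact hu.2 ⟨hu.1, fun h' => hc h'⟩
  have h' := (((List.finite_length_eq α n).subset Set.sdiff_subset).eventually_all).2 h
  obtain ⟨N, hN⟩ := Filter.eventually_atTop.1 h'
  refine ⟨N, fun i hi => ?_⟩
  by_contra hc
  exact hN i hi _ ⟨length_block _ _ _, hc⟩ rfl

lemma ncard_limitWords_lt (hw : ¬ IsEventuallyPeriodic w) (n : ℕ) :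
    (limitWords w n).ncard < (limitWords w (n + 1)).ncard := by
  obtain ⟨N, hN⟩ := exists_block_mem_limitWords w (n + 1)
  have hsub : limitWords w n ⊆ List.dropLast '' limitWords w (n + 1) := by
    rintro u ⟨-, hu⟩
    obtain ⟨i, hi, hb⟩ := Filter.frequently_atTop.1 hu N
    exact ⟨_, hN i hi, by rw [block_succ', List.dropLast_concat, hb]⟩
  have hfin := finite_limitWords w (n + 1)
  refine (Set.ncard_le_ncard hsub (hfin.image _)).trans_lt ?_
  refine lt_of_le_of_ne (Set.ncard_image_le hfin) fun heq => ?_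
  -- a right special block among the late blocks shows that `dropLast` is not injective
  have hinj := Set.injOn_of_ncard_image_eq heq hfin
  obtain ⟨i, j, hi, hj, hb, hne⟩ := exists_right_special hw n N
  have := hinj (hN i hi) (hN j hj) (by
    rw [block_succ', block_succ', List.dropLast_concat, List.dropLast_concat, hb])
  rw [block_succ', block_succ', hb] at this
  exact hne (List.singleton_inj.1 (List.append_cancel_left this))

lemma le_ncard_limitWords (hw : ¬ IsEventuallyPeriodic w) (n : ℕ) :
    n ≤ (limitWords w n).ncard := by
  induction n with
  | zero => exact Nat.zero_le _
  | succ n ih => exact Nat.succ_le_of_lt (ih.trans_lt (ncard_limitWords_lt hw n))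

/-- In a word that is not eventually periodic one finds `d` distinct blocks of equal length, in
consecutive places that do not overlap. -/
lemma exists_disjoint_blocks (hw : ¬ IsEventuallyPeriodic w) {d : ℕ} (hd : 0 < d) :
    ∃ p : ℕ → ℕ, (∀ s, p s + d ≤ p (s + 1)) ∧
      ∀ s < d, ∀ t < d, block w (p s) d = block w (p t) d → s = t := by
  obtain ⟨v, hv, hinj⟩ : ∃ v : ℕ → List α, (∀ s, v s ∈ limitWords w d) ∧
      ∀ s < d, ∀ t < d, v s = v t → s = t := by
    have hfin := (finite_limitWords w d).to_subtype
    have : Fintype (limitWords w d) := Fintype.ofFinite _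
    have hcard : Fintype.card (Fin d) ≤ Fintype.card (limitWords w d) := by
      rw [Fintype.card_fin, ← Nat.card_eq_fintype_card, Nat.card_coe_set_eq]
      exact le_ncard_limitWords hw d
    obtain ⟨e⟩ := Function.Embedding.nonempty_of_card_le hcard
    refine ⟨fun s => if h : s < d then e ⟨s, h⟩ else e ⟨0, hd⟩, fun s => ?_, fun s hs t ht h => ?_⟩
    · dsimp only; split_ifs <;> exact Subtype.coe_prop _
    · simpa [hs, ht, Subtype.val_inj] using h
  have hex : ∀ s N, ∃ i, N ≤ i ∧ block w i d = v s := fun s N => by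
    obtain ⟨i, hi⟩ := Filter.frequently_atTop.1 (hv s).2 N
    exact ⟨i, hi⟩
  choose q hq hqv using hex
  let p : ℕ → ℕ := fun s => Nat.rec (q 0 0) (fun s r => q (s + 1) (r + d)) s
  have hp : ∀ s, block w (p s) d = v s := fun s => by
    cases s <;> exact hqv _ _
  refine ⟨p, fun s => hq _ _, fun s hs t ht h => hinj s hs t ht ?_⟩
  rwa [hp, hp] at h

end Periodicity

/-! ### Just infinite algebras and uniform recurrence -/

section JustInfinite

variable {k : Type*} [Field k] {α : Type*} {w : ℕ → α}

/-- A quotient of `A_w` is infinite-dimensional if in each degree `n` some entry on the `n`-th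
diagonal vanishes on the kernel: the corresponding words stay linearly independent. -/
lemma not_finite_of_entry {B : Type*} [Ring B] [Algebra k B] (π : Alg k w →ₐ[k] B)
    (h : ∀ n, ∃ i, ∀ x, π x = 0 → entry i (i + n) x = 0) : ¬ Module.Finite k B := by
  intro hfin
  choose i hi using h
  have hli : LinearIndependent k fun n => π (word k w (block w (i n) n)) := by
    rw [linearIndependent_iff']
    intro s g hs n hn
    simp_rw [← map_smul, ← map_sum] at hs
    have h0 := hi n _ hs
    rw [map_sum, Finset.sum_eq_single n, map_smul, entry_word_block, smul_eq_mul, mul_one] at h0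
    · exact h0
    · intro m _ hm
      rw [map_smul, entry_word, if_neg, smul_zero]
      rw [length_block]
      omega
    · exact fun h' => absurd hn h'
  exact not_finite_iff_infinite.2 (inferInstance : Infinite ℕ) hli.finite_of_isNoetherian

/-- If `v` does not occur in the block between `i` and `i + n`, then that entry vanishes on the
ideal generated by `v`. -/
lemma entry_eq_zero_of_mem_span {v : List α} {i n : ℕ} (h : ¬ v <:+: block w i n) {x : Alg k w}
    (hx : x ∈ TwoSidedIdeal.span {word k w v}) : entry i (i + n) x = 0 := by
  let J : TwoSidedIdeal (Alg k w) := TwoSidedIdeal.mk'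
    {x | ∀ i n, ¬ v <:+: block w i n → entry i (i + n) x = 0}
    (fun i n _ => map_zero _)
    (fun {x y} hx hy i n h => by rw [map_add, hx i n h, hy i n h, add_zero])
    (fun {x} hx i n h => by rw [map_neg, hx i n h, neg_zero])
    (fun {x y} hy i n h => by
      rw [entry_mul]
      refine Finset.sum_eq_zero fun m hm => ?_
      rw [Finset.mem_Icc] at hm
      obtain ⟨c, hc⟩ := Nat.exists_eq_add_of_le hm.2
      rw [hc, hy m c fun h' => h (h'.trans (block_infix hm.1 hc.ge)), mul_zero])
    (fun {x y} hx i n h => by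
      rw [entry_mul]
      refine Finset.sum_eq_zero fun m hm => ?_
      rw [Finset.mem_Icc] at hm
      obtain ⟨c, rfl⟩ := Nat.exists_eq_add_of_le hm.1
      rw [hx i c fun h' => h (h'.trans (block_infix le_rfl hm.2)), zero_mul])
  have hJ : TwoSidedIdeal.span {word k w v} ≤ J := by
    rw [TwoSidedIdeal.span_le, Set.singleton_subset_iff]
    refine (TwoSidedIdeal.mem_mk' _ _ _ _ _ _ _).2 fun i n h => ?_
    rw [entry_word, if_neg]
    rintro ⟨h1, h2⟩
    obtain rfl : n = v.length := by omega
    rw [h2] at h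
    exact h List.infix_rfl
  exact (TwoSidedIdeal.mem_mk' _ _ _ _ _ _ _).1 (hJ hx) i n h

lemma IsJustInfinite.isUniformlyRecurrent (h : IsJustInfinite k (Alg k w)) :
    IsUniformlyRecurrent w := by
  intro v hv
  by_contra! hN
  obtain ⟨i₀, hi₀⟩ := hv
  let I := TwoSidedIdeal.span {word k w v}
  have hvI : word k w v ∈ I := TwoSidedIdeal.subset_span rfl
  refine not_finite_of_entry (I.ringCon.mkₐ k) (fun n => ?_) (h.2 I fun hI => ?_)
  · obtain ⟨i, hi⟩ := hN n
    exact ⟨i, fun x hx => entry_eq_zero_of_mem_span hi ((RingCon.eq _).1 hx)⟩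
  · rw [hI, TwoSidedIdeal.mem_bot] at hvI
    have := entry_word_block (k := k) (w := w) i₀ v.length
    rw [hi₀, hvI, map_zero] at this
    exact zero_ne_one this

/-- There is a degree-lexicographic order on words, here encoded by numbers: the letters are
read as nonzero digits. -/
lemma exists_deglex (α : Type*) [Finite α] : ∃ f : List α → ℕ, Function.Injective f ∧
    ∀ p q u v : List α, f u < f v → f (p ++ u ++ q) < f (p ++ v ++ q) := by
  obtain ⟨r, ⟨e⟩⟩ := Finite.exists_equiv_fin α
  let D : List α → List ℕ := List.map fun a => (e a : ℕ) + 1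
  have hD : Function.Injective D := List.map_injective_iff.2 fun a b h => by
    simpa [Fin.val_inj] using h
  have hdig : ∀ u, Nat.digits (r + 2) (Nat.ofDigits (r + 2) (D u)) = D u := fun u => by
    refine Nat.digits_ofDigits _ (by omega) _ (fun l hl => ?_) fun h => ?_
    · obtain ⟨a, -, rfl⟩ := List.mem_map.1 hl
      have := (e a).2
      omega
    · obtain ⟨a, -, ha⟩ := List.mem_map.1 (List.getLast_mem h)
      omega
  have hlen : ∀ u, (D u).length = u.length := fun u => List.length_map _
  refine ⟨fun u => Nat.ofDigits (r + 2) (D u), fun u v h => hD ?_, fun p q u v h => ?_⟩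
  · rw [← hdig u, ← hdig v]
    exact congrArg _ h
  · have hle : u.length ≤ v.length := by
      rw [← hlen, ← hlen, ← hdig u, ← hdig v]
      exact Nat.le_length_digits_le _ _ _ h.le
    have happ : ∀ x y, D (x ++ y) = D x ++ D y := fun x y => List.map_append
    simp only [happ, Nat.ofDigits_append, List.length_append, hlen]
    have h1 : (r + 2) ^ p.length * Nat.ofDigits (r + 2) (D u) <
        (r + 2) ^ p.length * Nat.ofDigits (r + 2) (D v) := by gcongr
    have h2 : (r + 2) ^ (p.length + u.length) * Nat.ofDigits (r + 2) (D q) ≤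
        (r + 2) ^ (p.length + v.length) * Nat.ofDigits (r + 2) (D q) := by gcongr; omega
    omega

/-- Modulo an ideal that contains an element with leading word `u`, each word that contains `u`
is a combination of smaller words. As all long subwords of `w` contain `u`, the quotient is
spanned by short words. -/
lemma IsUniformlyRecurrent.finite_quotient [Finite α] (hw : IsUniformlyRecurrent w)
    {I : TwoSidedIdeal (Alg k w)} (hI : I ≠ ⊥) : Module.Finite k I.ringCon.Quotient := by
  classical
  obtain ⟨f, hf, hmono⟩ := exists_deglex α
  obtain ⟨x, hxI, hx⟩ : ∃ x ∈ I, x ≠ 0 := by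
    by_contra! h
    exact hI (le_bot_iff.1 fun x hx => (TwoSidedIdeal.mem_bot _).2 (h x hx))
  obtain ⟨c, hc, rfl⟩ := exists_eq_sum_word x
  have hne : c.support.Nonempty := by
    rw [Finsupp.support_nonempty_iff]
    rintro rfl
    simp at hx
  obtain ⟨u, hu, hmax⟩ := c.support.exists_max_image f hne
  obtain ⟨N, hN⟩ := hw u (hc u hu)
  let π := I.ringCon.mkₐ k
  let F := Submodule.span k ((fun v => π (word k w v)) '' {v : List α | v.length < N})
  have hlead : π (word k w u) =
      ∑ v ∈ c.support.erase u, (-((c u)⁻¹ * c v)) • π (word k w v) := by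
    have h0 : π (c.sum fun v r => r • word k w v) = 0 := (RingCon.eq _).2 hxI
    rw [Finsupp.sum, ← Finset.add_sum_erase _ _ hu, map_add, map_smul, map_sum] at h0
    have hcu := Finsupp.mem_support_iff.1 hu
    rw [← inv_smul_smul₀ hcu (π (word k w u)), eq_neg_of_add_eq_zero_left h0, smul_neg,
      Finset.smul_sum, ← Finset.sum_neg_distrib]
    refine Finset.sum_congr rfl fun v _ => ?_
    rw [map_smul, smul_smul]
    exact (neg_smul (R := k) ((c u)⁻¹ * c v) (π (word k w v))).symm
  have key : ∀ n v, f v = n → π (word k w v) ∈ F := by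
    intro n
    induction n using Nat.strong_induction_on with
    | _ n ih =>
      rintro v rfl
      by_cases hvN : v.length < N
      · exact Submodule.subset_span ⟨v, hvN, rfl⟩
      by_cases hv : IsSubword w v
      · obtain ⟨i, hi⟩ := hv
        obtain ⟨p, q, rfl⟩ : u <:+: v := by
          rw [← hi]
          exact (hN i).trans (block_infix le_rfl (by omega))
        rw [word_append, word_append, map_mul, map_mul, hlead, Finset.mul_sum, Finset.sum_mul]
        refine Submodule.sum_mem _ fun t ht => ?_
        rw [Finset.mem_erase] at ht
        rw [mul_smul_comm, smul_mul_assoc, ← map_mul, ← map_mul, ← word_append, ← word_append]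
        exact Submodule.smul_mem _ _ (ih _ (hmono p q t u
          ((hmax t ht.2).lt_of_ne fun h => ht.1 (hf h))) _ rfl)
      · rw [word_eq_zero hv, map_zero]
        exact zero_mem _
  have hF : F = ⊤ := by
    rw [eq_top_iff]
    rintro y -
    obtain ⟨x, rfl⟩ := RingCon.mkₐ_surjective (α := k) I.ringCon y
    induction x using induction_word with
    | hw v => exact key _ v rfl
    | h0 => rw [map_zero]; exact zero_mem _
    | hadd x y hx hy => rw [map_add]; exact add_mem hx hy
    | hsmul r x hx => rw [map_smul]; exact Submodule.smul_mem _ _ hx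
  exact Module.finite_def.2 (hF ▸ Submodule.fg_span ((List.finite_length_lt α N).image _))

theorem isJustInfinite_iff [Finite α] :
    IsJustInfinite k (Alg k w) ↔ IsUniformlyRecurrent w :=
  ⟨IsJustInfinite.isUniformlyRecurrent, fun h =>
    ⟨not_finite_of_entry (AlgHom.id k _) fun n => ⟨0, fun x hx => by
      rw [show x = 0 from hx, map_zero]⟩, fun _ => h.finite_quotient⟩⟩

end JustInfinite

open Polynomial MulOpposite

/-! ### Polynomial identities force eventual periodicity -/

section PI

variable {k : Type*} [Field k] {α : Type*} {w : ℕ → α}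

lemma entry_word_mul_of_ne {i j : ℕ} {u : List α} (h : block w i u.length ≠ u) (y : Alg k w) :
    entry i j (word k w u * y) = 0 := by
  rw [entry_mul]
  refine Finset.sum_eq_zero fun m _ => ?_
  rw [entry_word, if_neg fun h' => h h'.2, zero_mul]

lemma lift_monomial {ι A : Type*} [Ring A] [Algebra k A] (g : ι → A) (l : List ι) :
    FreeAlgebra.lift k g (monomial k l) = (l.map g).prod := by
  simp [monomial, map_list_prod, Function.comp_def]

/-- Let `m` be a monomial of the identity, and let `p` be the starting points of distinct
blocks far apart. The variable `j` is replaced by the sum of the words between `p s` and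
`p (s + 1)`, over all `s` such that `j` is the `s`-th letter of `m`. From position `p s` only the
`s`-th of these words can be read, so `m` is the only monomial that contributes to the
entry between the first and the last point. -/
lemma IsPI.isEventuallyPeriodic [Finite α] (h : IsPI k (Alg k w)) : IsEventuallyPeriodic w := by
  classical
  by_contra hw
  obtain ⟨f, hf, hfg⟩ := h
  obtain ⟨c, rfl⟩ := (Finsupp.mem_span_range_iff_exists_finsupp).1
    (show f ∈ Submodule.span k (Set.range (monomial k)) from span_monomial k ▸ trivial)
  obtain ⟨m, hm⟩ : c.support.Nonempty := by
    rw [Finsupp.support_nonempty_iff]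
    rintro rfl
    simp at hf
  set d := m.length with hd
  obtain ⟨p, hp, hinj⟩ := exists_disjoint_blocks hw (Nat.succ_pos d)
  have hmono : StrictMono p := strictMono_nat_of_lt_succ fun s => by have := hp s; omega
  let u : ℕ → List α := fun s => block w (p s) (p (s + 1) - p s)
  have hu : ∀ s ≤ d, ∀ t ≤ d, block w (p s) (u t).length = u t → s = t := by
    intro s hs t ht h
    refine hinj s (by omega) t (by omega) ?_
    rw [length_block, block_eq_iff] at h
    rw [block_eq_iff]
    intro l hl
    exact h l (by have := hp t; omega)
  let g : ℕ → Alg k w := fun j =>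
    ∑ t ∈ Finset.range d, if m[t]? = some j then word k w (u t) else 0
  have hstep : ∀ s ≤ d, ∀ (a j : ℕ) (y : Alg k w), entry (p s) j (g a * y) =
      if m[s]? = some a then entry (p (s + 1)) j y else 0 := by
    intro s hs a j y
    have hterm : ∀ t ∈ Finset.range d, t ≠ s →
        entry (p s) j ((if m[t]? = some a then word k w (u t) else 0) * y) = 0 := by
      intro t ht hts
      split_ifs
      · rw [Finset.mem_range] at ht
        exact entry_word_mul_of_ne (fun h => hts (hu s hs t ht.le h).symm) y
      · rw [zero_mul, map_zero]
    rw [Finset.sum_mul, map_sum, Finset.sum_eq_single s hterm]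
    · split_ifs
      · rw [entry_word_mul, Nat.add_sub_cancel' (hmono (Nat.lt_succ_self s)).le]
      · rw [zero_mul, map_zero]
    · intro hs'
      rw [List.getElem?_eq_none (by simp at hs'; omega)]
      simp
  have hpath : ∀ (l : List ℕ) (s : ℕ), s ≤ d →
      entry (p s) (p d) (l.map g).prod = if l = m.drop s then 1 else 0 := by
    intro l
    induction l with
    | nil =>
      intro s hs
      rw [List.map_nil, List.prod_nil, ← word_nil, entry_word]
      congr 1
      have hnil : [] = m.drop s ↔ d = s := by
        rw [eq_comm, List.drop_eq_nil_iff]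
        omega
      simp [hnil, hmono.injective.eq_iff]
    | cons a l ih =>
      intro s hs
      rw [List.map_cons, List.prod_cons, hstep s hs]
      rcases hs.lt_or_eq with hlt | rfl
      · have hiff : a :: l = m.drop s ↔ m[s]? = some a ∧ l = m.drop (s + 1) := by
          rw [List.drop_eq_getElem_cons hlt, List.getElem?_eq_getElem hlt, Option.some_inj,
            List.cons_eq_cons, eq_comm (a := a)]
        rw [ih (s + 1) hlt, ← ite_and]
        simp only [hiff]
      · rw [List.drop_eq_nil_of_le (by omega), List.getElem?_eq_none (by omega)]
        simp
  have h0 := congrArg (entry (p 0) (p d)) (hfg g)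
  rw [map_zero, Finsupp.sum, map_sum, map_sum, Finset.sum_eq_single m] at h0
  · rw [map_smul, map_smul, lift_monomial, hpath _ _ (Nat.zero_le _), if_pos (by simp),
      smul_eq_mul, mul_one] at h0
    exact Finsupp.mem_support_iff.1 hm h0
  · intro l _ hl
    rw [map_smul, map_smul, lift_monomial, hpath _ _ (Nat.zero_le _), if_neg (by simpa using hl),
      smul_zero]
  · exact fun h' => absurd hm h'

/-! ### The standard identity -/

/-- The standard polynomial of degree `n`: the signed sum of all orderings of `n` variables. -/
noncomputable def standardPolynomial (k : Type*) [Field k] (n : ℕ) : FreeAlgebra k ℕ :=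
  ∑ σ : Equiv.Perm (Fin n),
    Equiv.Perm.sign σ • monomial k (List.ofFn fun i => (σ i : ℕ))

lemma standardPolynomial_ne_zero (n : ℕ) : standardPolynomial k n ≠ 0 := by
  intro h
  have hone : block (id : ℕ → ℕ) 0 n = List.ofFn fun i : Fin n => (i : ℕ) := by
    simp [block, List.ofFn_eq_map, List.map_coe_finRange_eq_range]
  -- the coefficient of the ordered monomial, read off in the shift representation of `0, 1, 2, …`
  have h0 := congrArg (fun x => freeShiftRep k id x (Pi.single n 1) 0) h
  simp only [standardPolynomial, map_sum, map_zero, LinearMap.sum_apply, Finset.sum_apply] at h0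
  rw [Finset.sum_eq_single 1] at h0
  · simp [freeShiftRep_monomial, hone] at h0
  · intro σ _ hσ
    rw [Units.smul_def, map_zsmul, LinearMap.smul_apply, Pi.smul_apply, freeShiftRep_monomial,
      if_neg, smul_zero]
    rw [List.length_ofFn, hone]
    intro he
    refine hσ (Equiv.ext fun i => Fin.ext ?_)
    exact (congrFun (List.ofFn_injective he) i).symm
  · simp

/-- As an alternating multilinear map, the standard polynomial vanishes on matrices as soon as
its degree exceeds the number of matrix entries. -/
lemma sum_sign_prod_matrix_eq_zero {R : Type*} [CommRing R] [IsDomain R] {d n : ℕ}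
    (hn : d * d < n) (v : Fin n → Matrix (Fin d) (Fin d) R) :
    ∑ σ : Equiv.Perm (Fin n),
      Equiv.Perm.sign σ • (List.ofFn fun i => v (σ i)).prod = 0 := by
  have h := (MultilinearMap.alternatization
    (MultilinearMap.mkPiAlgebraFin R n (Matrix (Fin d) (Fin d) R))).map_linearDependent v
    fun hli => by
      have := hli.fintype_card_le_finrank
      rw [Fintype.card_fin, Module.finrank_matrix] at this
      simp at this
      omega
  rw [MultilinearMap.alternatization_apply] at h
  simpa using h

lemma exists_sum_sign_prod_end_eq_zero (R M : Type*) [CommRing R] [IsDomain R] [AddCommGroup M]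
    [Module R M] [Module.Finite R M] : ∃ n : ℕ, ∀ v : Fin n → Module.End R M,
    ∑ σ : Equiv.Perm (Fin n),
      Equiv.Perm.sign σ • (List.ofFn fun i => v (σ i)).prod = 0 := by
  obtain ⟨d, b, hb⟩ := Module.Finite.exists_fin (R := R) (M := M)
  refine ⟨d * d + 1, fun v => ?_⟩
  choose m hm using fun i => Matrix.isRepresentation.toEnd_surjective R b hb (v i)
  have h0 : ∑ σ : Equiv.Perm (Fin (d * d + 1)),
      Equiv.Perm.sign σ • (List.ofFn fun i => m (σ i)).prod = 0 := by
    apply Subtype.ext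
    have := sum_sign_prod_matrix_eq_zero (Nat.lt_succ_self (d * d)) fun i => (m i).1
    rw [← Subalgebra.coe_val, map_sum]
    refine Eq.trans ?_ (this.trans (map_zero _).symm)
    refine Finset.sum_congr rfl fun σ _ => ?_
    rw [Units.smul_def, map_zsmul, map_list_prod, List.map_ofFn]
    rfl
  have h1 := congrArg (Matrix.isRepresentation.toEnd R b hb) h0
  rw [map_sum, map_zero] at h1
  rw [← h1]
  refine Finset.sum_congr rfl fun σ _ => ?_
  simp only [Units.smul_def, map_zsmul, map_list_prod, List.map_ofFn, Function.comp_def, hm]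

end PI

/-! ### Eventually periodic words -/

section EventuallyPeriodic

variable {k : Type*} [Field k] {α : Type*} {w : ℕ → α}

/-- The right action of `k[X]` on an algebra in which `X` acts as an element `z`. -/
noncomputable abbrev rightAevalModule (k : Type*) [Field k] {A : Type*} [Ring A] [Algebra k A]
    (z : A) : Module k[X] A :=
  Module.compHom A (aeval (op z) : k[X] →ₐ[k] Aᵐᵒᵖ).toRingHom

/-- If `w` has period `p` from position `n₀` on, and `z` is the sum of the distinct blocks of
length `p` beyond `n₀`, then right multiplication by `z` extends each long subword of `w` by `p`
letters: a long word ends in a full period, which must repeat. -/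
lemma IsEventuallyPeriodic.exists_finite [Finite α] (hw : IsEventuallyPeriodic w) :
    ∃ z : Alg k w, @Module.Finite k[X] (Alg k w) _ _ (rightAevalModule k z) := by
  classical
  obtain ⟨p, hp, n₀, hper⟩ := hw
  have hblock : ∀ i n, n₀ + p ≤ i + n → p ≤ n → block w (i + n) p = block w (i + (n - p)) p := by
    intro i n h hn
    rw [block_eq_iff]
    intro l _
    rw [← hper (i + (n - p) + l) (by omega)]
    congr 1
    omega
  have hfin : {v | ∃ i, n₀ ≤ i ∧ block w i p = v}.Finite :=
    (List.finite_length_eq α p).subset fun v ⟨i, _, hv⟩ => hv ▸ length_block _ _ _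
  let V := hfin.toFinset
  let z : Alg k w := ∑ v ∈ V, word k w v
  have hz : ∀ i n, n₀ + p ≤ n →
      word k w (block w i n) * z = word k w (block w i (n + p)) := by
    intro i n hn
    rw [Finset.mul_sum, Finset.sum_eq_single (block w (i + n) p), ← word_append, ← block_add]
    · intro v hv hne
      rw [← word_append]
      refine word_eq_zero ?_
      rintro ⟨j, hj⟩
      have h1 := block_append_eq hj
      obtain ⟨i', -, rfl⟩ := hfin.mem_toFinset.1 hv
      rw [length_block, length_block] at h1
      refine hne ?_
      rw [← h1.2, hblock j n (by omega) (by omega), hblock i n (by omega) (by omega)]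
      rw [block_eq_iff] at h1 ⊢
      intro l hl
      have := h1.1 (n - p + l) (by omega)
      rwa [← add_assoc, ← add_assoc] at this
    · intro h
      exact absurd (hfin.mem_toFinset.2 ⟨i + n, by omega, rfl⟩) h
  refine ⟨z, ?_⟩
  let := rightAevalModule k z
  have hX : ∀ x : Alg k w, (X : k[X]) • x = x * z := fun x => by
    change (aeval (op z) X : (Alg k w)ᵐᵒᵖ) • x = x * z
    rw [aeval_X]
    rfl
  have hC : ∀ (c : k) (x : Alg k w), (C c : k[X]) • x = c • x := fun c x => by
    change (aeval (op z) (C c) : (Alg k w)ᵐᵒᵖ) • x = c • x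
    rw [aeval_C, Algebra.smul_def, Algebra.commutes]
    rfl
  let F := Submodule.span k[X] (word k w '' {v : List α | v.length < n₀ + p + p})
  have key : ∀ n v, v.length = n → word k w v ∈ F := by
    intro n
    induction n using Nat.strong_induction_on with
    | _ n ih =>
      intro v hv
      by_cases hlt : v.length < n₀ + p + p
      · exact Submodule.subset_span ⟨v, hlt, rfl⟩
      by_cases hsub : IsSubword w v
      · obtain ⟨i, hi⟩ := hsub
        have hlen : v.length = v.length - p + p := by omega
        rw [← hi, hlen, ← hz i _ (by omega), ← hX]
        exact Submodule.smul_mem _ _ (ih (v.length - p) (by omega) _ (length_block _ _ _))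
      · rw [word_eq_zero hsub]
        exact zero_mem _
  have hF : F = ⊤ := by
    rw [eq_top_iff]
    rintro x -
    induction x using induction_word with
    | hw v => exact key _ v rfl
    | h0 => exact zero_mem _
    | hadd x y hx hy => exact add_mem hx hy
    | hsmul r x hx => rw [← hC]; exact Submodule.smul_mem _ _ hx
  exact Module.finite_def.2 (hF ▸ Submodule.fg_span ((List.finite_length_lt α _).image _))

lemma isNoetherian_of_finite_rightAevalModule {A : Type*} [Ring A] [Algebra k A] (z : A)
    (h : @Module.Finite k[X] A _ _ (rightAevalModule k z)) : IsRightNoetherian A := by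
  let := rightAevalModule k z
  let : Module k[X] Aᵐᵒᵖ := Module.compHom Aᵐᵒᵖ (aeval (op z) : k[X] →ₐ[k] Aᵐᵒᵖ).toRingHom
  have : IsScalarTower k[X] Aᵐᵒᵖ A := ⟨fun q b a => by
    change ((aeval (op z) q : Aᵐᵒᵖ) * b) • a = (aeval (op z) q : Aᵐᵒᵖ) • b • a
    rw [mul_smul]⟩
  have : IsNoetherian Aᵐᵒᵖ A :=
    isNoetherian_of_tower k[X] (isNoetherian_of_isNoetherianRing_of_finite k[X] A)
  let e : A ≃ₗ[Aᵐᵒᵖ] Aᵐᵒᵖ :=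
    { opAddEquiv with map_smul' := fun _ _ => rfl }
  exact isNoetherian_of_linearEquiv e

/-- Left multiplication embeds `A` into the endomorphisms of a finitely generated module over a
commutative domain, and these satisfy a standard identity. -/
lemma isPI_of_finite_rightAevalModule {A : Type*} [Ring A] [Algebra k A] (z : A)
    (h : @Module.Finite k[X] A _ _ (rightAevalModule k z)) : IsPI k A := by
  let := rightAevalModule k z
  obtain ⟨n, hn⟩ := exists_sum_sign_prod_end_eq_zero k[X] A
  let L : A →+* Module.End k[X] A :=
    { toFun := fun a =>
        { toFun := fun x => a * x
          map_add' := mul_add a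
          map_smul' := fun q x =>
            (mul_assoc a x (unop (aeval (op z) q : Aᵐᵒᵖ))).symm }
      map_one' := LinearMap.ext one_mul
      map_mul' := fun a b => LinearMap.ext (mul_assoc a b)
      map_zero' := LinearMap.ext zero_mul
      map_add' := fun a b => LinearMap.ext (add_mul a b) }
  have hL : Function.Injective L := fun a b hab => by
    have := LinearMap.congr_fun hab (1 : A)
    rwa [show L a 1 = a from mul_one a, show L b 1 = b from mul_one b] at this
  refine ⟨standardPolynomial k n, standardPolynomial_ne_zero n, fun g => hL ?_⟩
  rw [map_zero, ← hn fun i => L (g i), standardPolynomial, map_sum, map_sum]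
  refine Finset.sum_congr rfl fun σ _ => ?_
  rw [Units.smul_def, map_zsmul, map_zsmul, lift_monomial, map_list_prod, List.map_ofFn,
    List.map_ofFn]
  rfl

theorem isPI_iff [Finite α] : IsPI k (Alg k w) ↔ IsEventuallyPeriodic w :=
  ⟨IsPI.isEventuallyPeriodic, fun h =>
    have ⟨z, hz⟩ := h.exists_finite (k := k)
    isPI_of_finite_rightAevalModule z hz⟩

end EventuallyPeriodic

/-! ### Right noetherian algebras -/

section Noetherian

variable {k : Type*} [Field k] {α : Type*} {w : ℕ → α}

/-- A word is bad if it has arbitrarily long right special extensions. -/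
def IsBad (w : ℕ → α) (x : List α) : Prop :=
  ∀ n, ∃ i j m, n ≤ m ∧ x <+: block w i m ∧ block w i m = block w j m ∧ w (i + m) ≠ w (j + m)

/-- A bad word `x` has two different extensions of the same length one of which is bad. Take two
extensions that leave a right special extension of `x`: some extension of their length is bad,
and at least one of the two differs from it. -/
lemma IsBad.exists_extensions [Finite α] {x : List α} (hx : IsBad w x) :
    ∃ x' y, IsBad w x' ∧ x <+: x' ∧ x <+: y ∧ IsSubword w y ∧ y.length = x'.length ∧ y ≠ x' := by
  obtain ⟨i, j, m, -, hxi, hij, hne⟩ := hx 0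
  obtain ⟨x', hx', hlen, hbad⟩ : ∃ x', x <+: x' ∧ x'.length = m + 1 ∧ IsBad w x' := by
    have hxm : x.length ≤ m := by simpa using hxi.length_le
    by_contra! hc
    have hall : ∀ u ∈ {u : List α | u.length = m + 1}, ∃ N, ∀ n, N ≤ n → x <+: u →
        ∀ i j, u <+: block w i n → block w i n = block w j n → w (i + n) = w (j + n) := by
      intro u hu
      by_cases hxu : x <+: u
      · have := hc u hxu hu
        unfold IsBad at this
        push Not at this
        obtain ⟨N, hN⟩ := this
        exact ⟨N, fun n hn _ i j h1 h2 => hN i j n hn h1 h2⟩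
      · exact ⟨0, fun n _ h => absurd h hxu⟩
    have hev := ((List.finite_length_eq α (m + 1)).eventually_all (l := Filter.atTop)
      (p := fun u n => x <+: u → ∀ i j, u <+: block w i n → block w i n = block w j n →
        w (i + n) = w (j + n))).2 fun u hu => Filter.eventually_atTop.2 (hall u hu)
    obtain ⟨N, hN⟩ := Filter.eventually_atTop.1 hev
    obtain ⟨i', j', n, hn, hxn, hb, hne'⟩ := hx (N + (m + 1))
    have hpre : block w i' (m + 1) <+: block w i' n := by
      obtain ⟨c, rfl⟩ := Nat.exists_eq_add_of_le (show m + 1 ≤ n by omega)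
      rw [block_add w i' (m + 1) c]
      exact List.prefix_append _ _
    exact hne' (hN n (by omega) (block w i' (m + 1)) (length_block _ _ _)
      (List.prefix_of_prefix_length_le hxn hpre (by simp; omega)) i' j' hpre hb)
  have hpi : x <+: block w i (m + 1) := by
    rw [block_succ']
    exact hxi.trans (List.prefix_append _ _)
  have hpj : x <+: block w j (m + 1) := by
    rw [block_succ', ← hij]
    exact hxi.trans (List.prefix_append _ _)
  by_cases h : block w i (m + 1) = x'
  · refine ⟨x', block w j (m + 1), hbad, hx', hpj, isSubword_block _ _ _, by simp [hlen], ?_⟩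
    rintro rfl
    rw [block_succ', block_succ', hij] at h
    exact hne (List.singleton_inj.1 (List.append_cancel_left h))
  · exact ⟨x', block w i (m + 1), hbad, hx', hpi, isSubword_block _ _ _, by simp [hlen], h⟩

/-- Take a right ideal `J` that is maximal among those with no coefficients at the extensions of
some bad word `x`. For the two extensions `x'`, `y` of `x`, with `x'` bad, the right ideal
`J + y A_w` is larger and has no coefficients at the extensions of `x'`. -/
lemma IsRightNoetherian.isEventuallyPeriodic [Finite α]
    (h : IsRightNoetherian (Alg k w)) : IsEventuallyPeriodic w := by
  by_contra hw
  have : IsNoetherian (Alg k w)ᵐᵒᵖ (Alg k w)ᵐᵒᵖ := h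
  let S : Set (Submodule (Alg k w)ᵐᵒᵖ (Alg k w)ᵐᵒᵖ) := {J | ∃ x, IsBad w x ∧
    ∀ a ∈ J, ∀ i n, x <+: block w i n → entry i (i + n) a.unop = 0}
  have hS : S.Nonempty := by
    refine ⟨⊥, [], fun n => ?_, fun a ha i n _ => ?_⟩
    · obtain ⟨i, j, -, -, hb, hne⟩ := exists_right_special hw n 0
      exact ⟨i, j, n, le_rfl, List.nil_prefix, hb, hne⟩
    · rw [(Submodule.mem_bot _).1 ha, unop_zero, map_zero]
  obtain ⟨J, ⟨x, hx, hJ⟩, hmax⟩ := set_has_maximal_iff_noetherian.2 this S hS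
  obtain ⟨x', y, hx', hxx', hxy, ⟨i₀, hi₀⟩, hlen, hne⟩ := hx.exists_extensions
  refine hmax (J ⊔ Submodule.span _ {op (word k w y)}) ⟨x', hx', fun a ha i n hin => ?_⟩
    (lt_of_le_of_ne le_sup_left fun heq => ?_)
  · obtain ⟨b, hb, c, hc, rfl⟩ := Submodule.mem_sup.1 ha
    obtain ⟨r, rfl⟩ := Submodule.mem_span_singleton.1 hc
    have hyb : block w i y.length ≠ y := by
      intro hy
      have hpre : y <+: block w i n := by
        obtain ⟨e, rfl⟩ := Nat.exists_eq_add_of_le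
          (show y.length ≤ n by simpa [hlen] using hin.length_le)
        rw [block_add, hy]
        exact List.prefix_append _ _
      exact hne ((List.prefix_of_prefix_length_le hpre hin hlen.le).eq_of_length hlen)
    rw [unop_add, map_add, hJ b hb i n (hxx'.trans hin), smul_eq_mul, unop_mul, unop_op,
      entry_word_mul_of_ne hyb, add_zero]
  · have hy : op (word k w y) ∈ J := by
      rw [heq]
      exact Submodule.mem_sup_right (Submodule.mem_span_singleton_self _)
    have h0 := hJ _ hy i₀ y.length (by rwa [hi₀])
    rw [unop_op, ← hi₀, length_block, entry_word_block] at h0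
    exact one_ne_zero h0

theorem isRightNoetherian_iff [Finite α] :
    IsRightNoetherian (Alg k w) ↔ IsEventuallyPeriodic w :=
  ⟨IsRightNoetherian.isEventuallyPeriodic, fun h =>
    have ⟨z, hz⟩ := h.exists_finite (k := k)
    isNoetherian_of_finite_rightAevalModule z hz⟩

end Noetherian

end IterativeAlgebra

open IterativeAlgebra in
theorem mainTheorem2 (k : Type*) [Field k] (α : Type*) [Finite α] (w : ℕ → α)
    (hw : IterativeAlgebra.IsPureMorphic w) (hocc : ∀ a : α, ∃ n : ℕ, w n = a) :
    (IterativeAlgebra.IsPrimeRing (IterativeAlgebra.Alg k w) ↔ ∃ n : ℕ, 0 < n ∧ w n = w 0) ∧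
    (IterativeAlgebra.IsSemiprimeRing (IterativeAlgebra.Alg k w) ↔
      IterativeAlgebra.IsPrimeRing (IterativeAlgebra.Alg k w)) ∧
    (IterativeAlgebra.IsJustInfinite k (IterativeAlgebra.Alg k w) ↔
      IterativeAlgebra.IsUniformlyRecurrent w) ∧
    (IterativeAlgebra.IsPI k (IterativeAlgebra.Alg k w) ↔
      IterativeAlgebra.IsEventuallyPeriodic w) ∧
    (IterativeAlgebra.IsRightNoetherian (IterativeAlgebra.Alg k w) ↔
      IterativeAlgebra.IsEventuallyPeriodic w) :=
  have hprime (h : ∃ n : ℕ, 0 < n ∧ w n = w 0) : IsPrimeRing (Alg k w) :=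
    isPrimeRing_of_recurrent (hw.recurrent h)
  ⟨⟨fun h => h.isSemiprimeRing.first_letter_recurs, hprime⟩,
    ⟨fun h => hprime h.first_letter_recurs, fun h => h.isSemiprimeRing⟩,
    isJustInfinite_iff, isPI_iff, isRightNoetherian_iff⟩
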